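/- Let $n\ge 1$ and let $k_1\le k_2\le\dots\le k_n$ be integers. A Gelfand--Tsetlin pattern with bottom row $(k_1,\dots,k_n)$ is an array of integers $(a_{i,j})_{1\le i\le j\le n}$ with $a_{1,j}=k_j$ for $1\le j\le n$, $a_{i,j}\le a_{i+1,j+1}$ for $1\le i\le j<n$, and $a_{i,j}\le a_{i-1,j}$ for $1<i\le j\le n$. It is called a weak monotone triangle if moreover $a_{i,j-1}<a_{i-1,j}$ whenever $1<i<j\le n$. The $P$-weight of a weak monotone triangle is $$\prod_{\substack{1<i\le j\le n\\ a_{i,j}<a_{i-1,j}}}\bigl(P^{a_{i,j}}-[a_{i,j}=a_{i,j-1}]\bigr),$$ where $[\cdot]$ is $1$ if the statement in brackets is true and $0$ otherwise, and $[a_{i,j}=a_{i,j-1}]$ is read as $0$ for $j=i$ (no left neighbour). Here $P$ is an indeterminate or, more generally, a nonzero element of a field with $P^m\ne 1$ for $1\le m<n$. For a function $f$ of the integer variables $k_1,\dots,k_n$ let $E_{k_x}$ be the shift operator that replaces $k_x$ by $k_x+1$, and set ${}_P\Delta_{k_x}=P^{-k_x}(E_{k_x}-\operatorname{id})$ and ${}_PE_{k_x}={}_P\Delta_{k_x}+\operatorname{id}$;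 these operators commute with each other. Then there are only finitely many weak monotone triangles with bottom row $(k_1,\dots,k_n)$, and the sum of their $P$-weights is $$P^{\binom{n+1}{3}}\;\prod_{1\le s<t\le n}\bigl({}_PE_{k_t}+{}_P\Delta_{k_s}\,{}_P\Delta_{k_t}\bigr)\;\prod_{1\le i<j\le n}\frac{P^{k_j}-P^{k_i}}{P^j-P^i},$$ where the product of operators is their composition, applied to the last product as a function of $(k_1,\dots,k_n)\in\mathbb Z^n$ and then evaluated at the given $(k_1,\dots,k_n)$. -/

import Mathlib

/-- A Gelfand–Tsetlin pattern `(a i j)`, `1 ≤ i ≤ j ≤ n`, of integers. Row `i = 1` is the bottom row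
and has `n` entries, row `i = n` is the top row and has one entry. The array is extended by `0`
outside of the index range, so that distinct functions are distinct patterns. -/
structure IsGelfandTsetlin (n : ℕ) (a : ℕ → ℕ → ℤ) : Prop where
  le_northeast : ∀ i j, 1 ≤ i → i ≤ j → j < n → a i j ≤ a (i + 1) (j + 1)
  le_southeast : ∀ i j, 1 < i → i ≤ j → j ≤ n → a i j ≤ a (i - 1) j
  zero_outside : ∀ i j, ¬ (1 ≤ i ∧ i ≤ j ∧ j ≤ n) → a i j = 0

/-- A weak monotone triangle with `n` rows. -/
structure IsWeakMonotoneTriangle (n : ℕ) (a : ℕ → ℕ → ℤ) : Prop extends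
    IsGelfandTsetlin n a where
  lt_of_ne_bottom : ∀ i j, 1 < i → i < j → j ≤ n → a i (j - 1) < a (i - 1) j

/-- The weak monotone triangles with bottom row `k`; `k j` is the entry in position `j + 1`. -/
def weakMonotoneTriangles {n : ℕ} (k : Fin n → ℤ) : Set (ℕ → ℕ → ℤ) :=
  {a | IsWeakMonotoneTriangle n a ∧ ∀ j : Fin n, a 1 ((j : ℕ) + 1) = k j}

/-- The index pairs of the entries `a i j` that have a southeast neighbour `a (i - 1) j` (that is,
`i ≠ 1`) and are strictly smaller than it. -/
def strictIndices (n : ℕ) (a : ℕ → ℕ → ℤ) : Finset (ℕ × ℕ) :=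
  (Finset.Icc 1 n ×ˢ Finset.Icc 1 n).filter
    fun p => 1 < p.1 ∧ p.1 ≤ p.2 ∧ a p.1 p.2 < a (p.1 - 1) p.2

/-- The `P`-weight of a triangle. The Iverson bracket is `0` for the leftmost entry `i = j` of a row,
which has no left neighbour. -/
def pWeight {K : Type*} [Field K] (P : K) (n : ℕ) (a : ℕ → ℕ → ℤ) : K :=
  ∏ p ∈ strictIndices n a,
    (P ^ a p.1 p.2 - if p.1 < p.2 ∧ a p.1 p.2 = a p.1 (p.2 - 1) then 1 else 0)

/-- The shift operator `E_{k_x}` on functions of `(k_1, …, k_n) ∈ ℤⁿ`. -/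
def shiftOp (K : Type*) [Field K] {n : ℕ} (x : Fin n) : Module.End K ((Fin n → ℤ) → K) where
  toFun f := fun k => f (Function.update k x (k x + 1))
  map_add' _ _ := rfl
  map_smul' _ _ := rfl

/-- Multiplication by the function `P ^ (-k_x)`. -/
def powNegOp {K : Type*} [Field K] (P : K) {n : ℕ} (x : Fin n) :
    Module.End K ((Fin n → ℤ) → K) where
  toFun f := fun k => P ^ (-k x) * f k
  map_add' _ _ := by ext; simp [mul_add]
  map_smul' _ _ := by ext; simp [mul_left_comm]

/-- The `P`-difference operator `P ^ (-k_x) (E_{k_x} - id)`. -/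
def pDelta {K : Type*} [Field K] (P : K) {n : ℕ} (x : Fin n) : Module.End K ((Fin n → ℤ) → K) :=
  powNegOp P x * (shiftOp K x - 1)

/-- The `P`-shift operator. -/
def pShift {K : Type*} [Field K] (P : K) {n : ℕ} (x : Fin n) : Module.End K ((Fin n → ℤ) → K) :=
  pDelta P x + 1

/-- The factor belonging to the pair `(s, t)`. -/
def pairOp {K : Type*} [Field K] (P : K) {n : ℕ} (p : Fin n × Fin n) :
    Module.End K ((Fin n → ℤ) → K) :=
  pShift P p.2 + pDelta P p.1 * pDelta P p.2

theorem pDelta_commute {K : Type*} [Field K] (P : K) {n : ℕ} (x y : Fin n) :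
    Commute (pDelta P x) (pDelta P y) := by
  rcases eq_or_ne x y with rfl | h
  · exact Commute.refl _
  · refine LinearMap.ext fun f => funext fun k => ?_
    simp only [pDelta, powNegOp, shiftOp, Module.End.mul_apply, LinearMap.sub_apply,
      Module.End.one_apply, LinearMap.coe_mk, AddHom.coe_mk, Pi.sub_apply,
      Function.update_of_ne h, Function.update_of_ne h.symm, Function.update_comm h]
    ring

theorem pairOp_commute {K : Type*} [Field K] (P : K) {n : ℕ} (p q : Fin n × Fin n) :
    Commute (pairOp P p) (pairOp P q) := by
  have h := pDelta_commute P (n := n)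
  have hl : ∀ x, Commute (pDelta P x) (pairOp P q) := fun x =>
    (((h x _).add_right (Commute.one_right _))).add_right ((h x _).mul_right (h x _))
  exact (((hl _).add_left (Commute.one_left _))).add_left ((hl _).mul_left (hl _))

/-- The composition of the factors over all pairs `s < t`; the factors commute. -/
def pairOpProd {K : Type*} [Field K] (P : K) (n : ℕ) : Module.End K ((Fin n → ℤ) → K) :=
  (Finset.univ.filter fun p : Fin n × Fin n => p.1 < p.2).noncommProd (pairOp P)
    fun p _ q _ _ => pairOp_commute P p q

/-- The product of `(P ^ k_j - P ^ k_i) / (P ^ j - P ^ i)` over `1 ≤ i < j ≤ n`, as a function of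
`k`. An element `i` of `Fin n` stands for the index `i + 1`. -/
def pVandermonde {K : Type*} [Field K] (P : K) (n : ℕ) : (Fin n → ℤ) → K := fun k =>
  ∏ p ∈ Finset.univ.filter (fun p : Fin n × Fin n => p.1 < p.2),
    (P ^ k p.2 - P ^ k p.1) / (P ^ ((p.2 : ℕ) + 1) - P ^ ((p.1 : ℕ) + 1))

/-! Induction on the number of rows. Let `X x` act as the `P`-difference in the variable `x`. The
claimed value is F_n = ∏_{s<t} (1 + X_t + X_s X_t) D_n (`operatorFormula`), where D_n is a
Vandermonde determinant in the powers of P whose columns are scaled so that a difference lowers the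
column index. The core is that F_n, summed with row weights over the rows fitting above k, gives
F_{n+1}(k) (`sum_rowWeight_operatorFormula`).

Expanding D_{n+1} along its constant column writes F_{n+1}(k) as Σ_i (-1)^i ∏_{t≥i} (1 + X_t) G_n,
evaluated at k with k_i deleted; G_n is the antiderivative of F_n in all variables
(`operatorFormula_succ`).

In the row sum the entries are summed from right to left. Each sum of a `P`-difference telescopes to
its two ends, and the extra summand of weight 1 turns the right end into 1 + X_t. The unwanted terms
have entry i at its right end and entry i+1 at its left end, hence equal entries. They combine
through the factor 1 + X_i + X_i X_{i+1}, and vanish: this factor makes the operator symmetric in i,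
i+1, while the determinant is alternating (`polyAct_pairPoly_operatorPrimitive`,
`PartialSum.sum_eq`).

The Iverson bracket leaves a correction that `PartialSum` carries along. Its degenerate case, three
equal neighbours, needs F_n to vanish there; this follows from the induction hypothesis, since no
triangle has such a bottom row. -/

open MvPolynomial

/-! ### Polynomials in the `P`-difference operators. -/

section Operators

variable {K : Type*} [Field K]

/-- The `P`-difference operator in the variable `x`, for an arbitrary set of variables. -/
def diffOp (P : K) {ι : Type*} [DecidableEq ι] (x : ι) : Module.End K ((ι → ℤ) → K) where
  toFun f := fun k => P ^ (-k x) * (f (Function.update k x (k x + 1)) - f k)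
  map_add' _ _ := by ext; simp only [Pi.add_apply]; ring
  map_smul' _ _ := by ext; simp only [Pi.smul_apply, smul_eq_mul, RingHom.id_apply]; ring

variable {ι κ : Type*} [DecidableEq ι] [DecidableEq κ]

theorem diffOp_apply (P : K) (x : ι) (f : (ι → ℤ) → K) (k : ι → ℤ) :
    diffOp P x f k = P ^ (-k x) * (f (Function.update k x (k x + 1)) - f k) := rfl

theorem diffOp_comm (P : K) (x y : ι) : diffOp P x * diffOp P y = diffOp P y * diffOp P x := by
  rcases eq_or_ne x y with rfl | h
  · rfl
  · refine LinearMap.ext fun f => funext fun k => ?_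
    simp only [Module.End.mul_apply, diffOp_apply, Function.update_of_ne h,
      Function.update_of_ne h.symm, Function.update_comm h]
    ring

/-- The action of polynomials on functions in which the variable `X x` acts by `diffOp P x`. -/
noncomputable def polyAct (P : K) (ι : Type*) [DecidableEq ι] :
    MvPolynomial ι K →ₐ[K] Module.End K ((ι → ℤ) → K) :=
  -- The differences commute, so they generate a commutative subalgebra, in which polynomials can be
  -- evaluated.
  letI : CommSemiring (Algebra.adjoin K (Set.range (diffOp P (ι := ι)))) :=
    { (Algebra.adjoin K (Set.range (diffOp P (ι := ι)))).toSemiring with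
      mul_comm := (Algebra.isMulCommutative_adjoin K (by
        rintro _ ⟨x, rfl⟩ _ ⟨y, rfl⟩
        exact diffOp_comm P x y)).is_comm.comm }
  (Algebra.adjoin K (Set.range (diffOp P (ι := ι)))).val.comp
    (MvPolynomial.aeval fun x => ⟨diffOp P x, Algebra.subset_adjoin ⟨x, rfl⟩⟩)

@[simp]
theorem polyAct_X (P : K) (x : ι) : polyAct P ι (X x) = diffOp P x := by
  simp [polyAct]

theorem polyAct_mul_apply (P : K) (p q : MvPolynomial ι K) (f : (ι → ℤ) → K) :
    polyAct P ι (p * q) f = polyAct P ι p (polyAct P ι q f) := by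
  rw [map_mul, Module.End.mul_apply]

/-- A linear map intertwining the actions of the variables intertwines the actions of all
polynomials. -/
theorem polyAct_intertwine (P : K) (T : ((ι → ℤ) → K) →ₗ[K] ((κ → ℤ) → K))
    (θ : κ → MvPolynomial ι K) (hT : ∀ x f, diffOp P x (T f) = T (polyAct P ι (θ x) f))
    (q : MvPolynomial κ K) (f : (ι → ℤ) → K) :
    polyAct P κ q (T f) = T (polyAct P ι (MvPolynomial.aeval θ q) f) := by
  induction q using MvPolynomial.induction_on generalizing f with
  | C a =>
    rw [← MvPolynomial.algebraMap_eq, AlgHom.commutes, AlgHom.commutes, AlgHom.commutes]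
    simp [Module.algebraMap_end_apply]
  | add p q hp hq => simp only [map_add, LinearMap.add_apply, hp, hq]
  | mul_X p x hp =>
    rw [polyAct_mul_apply, polyAct_X, hT, hp, map_mul, MvPolynomial.aeval_X, polyAct_mul_apply]

/-- Evaluation of the variable `x` at `c`. -/
def evalOp (K : Type*) [Field K] (x : ι) (c : ℤ) : Module.End K ((ι → ℤ) → K) :=
  LinearMap.funLeft K K fun l => Function.update l x c

theorem evalOp_apply (x : ι) (c : ℤ) (f : (ι → ℤ) → K) (l : ι → ℤ) :
    evalOp K x c f l = f (Function.update l x c) := rfl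

theorem diffOp_evalOp_self (P : K) (x : ι) (c : ℤ) (f : (ι → ℤ) → K) :
    diffOp P x (evalOp K x c f) = 0 := by
  ext k; simp [diffOp_apply, evalOp_apply]

theorem diffOp_evalOp (P : K) {x y : ι} (h : y ≠ x) (c : ℤ) (f : (ι → ℤ) → K) :
    diffOp P y (evalOp K x c f) = evalOp K x c (diffOp P y f) := by
  ext k
  simp only [diffOp_apply, evalOp_apply, Function.update_of_ne h, Function.update_comm h]

/-- Setting the variable `x` to zero in a polynomial. -/
noncomputable def killVar (K : Type*) [Field K] (x : ι) : MvPolynomial ι K →ₐ[K] MvPolynomial ι K :=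
  MvPolynomial.aeval fun y => if y = x then 0 else X y

theorem killVar_X_of_ne {x y : ι} (h : y ≠ x) : killVar K x (X y) = X y := by
  simp [killVar, h]

/-- After evaluation at `c` nothing depends on `x`, so `X x` acts as 0. Hence only polynomials free
of `X x`, as `hq` expresses, are moved through. -/
theorem polyAct_evalOp (P : K) (x : ι) (c : ℤ) {q : MvPolynomial ι K} (hq : killVar K x q = q)
    (f : (ι → ℤ) → K) : polyAct P ι q (evalOp K x c f) = evalOp K x c (polyAct P ι q f) := by
  rw [polyAct_intertwine P (evalOp K x c) (fun y => if y = x then 0 else X y)]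
  · rw [← killVar, hq]
  · intro y f
    by_cases h : y = x
    · subst h; simp [diffOp_evalOp_self]
    · simp [h, diffOp_evalOp]

/-- Summation by parts of a `P`-difference. -/
theorem sum_Ico_diffOp {P : K} (hP : P ≠ 0) (x : ι) (f : (ι → ℤ) → K) (l : ι → ℤ) {a b : ℤ}
    (hab : a ≤ b) :
    ∑ y ∈ Finset.Ico a b, P ^ y * diffOp P x f (Function.update l x y) =
      f (Function.update l x b) - f (Function.update l x a) := by
  induction b, hab using Int.leInduction with
  | base => simp
  | succ b hab ih =>
    have h : Finset.Ico a (b + 1) = insert b (Finset.Ico a b) := by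
      ext; simp only [Finset.mem_Ico, Finset.mem_insert]; omega
    rw [h, Finset.sum_insert (by simp), ih, diffOp_apply]
    simp only [Function.update_self, Function.update_idem]
    rw [← mul_assoc, ← zpow_add₀ hP]
    simp

end Operators

/-! ### Symmetry and specialization of the product of pair polynomials. -/

section PairPolynomial

variable (K : Type*) [Field K]

/-- The polynomial `1 + X t + X s * X t` of the pair `(s, t)`. -/
noncomputable def pairPoly {ι : Type*} (p : ι × ι) : MvPolynomial ι K :=
  X p.2 + 1 + X p.1 * X p.2

/-- The product of the pair polynomials over all `s < t < n`. -/
noncomputable def pairPolyProd (n : ℕ) : MvPolynomial ℕ K :=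
  ∏ p ∈ (Finset.range n ×ˢ Finset.range n).filter (fun p => p.1 < p.2), pairPoly K p

theorem pairPolyProd_eq (n : ℕ) :
    pairPolyProd K n = ∏ t ∈ Finset.range n, ∏ s ∈ Finset.range t, pairPoly K (s, t) := by
  rw [pairPolyProd, Finset.prod_filter, Finset.prod_product_right]
  refine Finset.prod_congr rfl fun t ht => ?_
  rw [← Finset.prod_filter]
  refine Finset.prod_congr ?_ fun _ _ => rfl
  ext s
  simp only [Finset.mem_range, Finset.mem_filter] at *
  omega

theorem pairPolyProd_succ (n : ℕ) :
    pairPolyProd K (n + 1) = pairPolyProd K n * ∏ s ∈ Finset.range n, pairPoly K (s, n) := by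
  rw [pairPolyProd_eq, pairPolyProd_eq, Finset.prod_range_succ]

/-- The transposition permutes all pairs s < t other than (i, i+1), and the extra factor is the
mirror image of the factor of that pair. -/
theorem rename_swap_pairPolyProd {n i : ℕ} (hi : i + 1 < n) :
    rename (Equiv.swap i (i + 1)) (pairPoly K (i + 1, i) * pairPolyProd K n) =
      pairPoly K (i + 1, i) * pairPolyProd K n := by
  have hmem : (i, i + 1) ∈ (Finset.range n ×ˢ Finset.range n).filter (fun p => p.1 < p.2) := by
    simp; omega
  have hren : ∀ p : ℕ × ℕ, rename (Equiv.swap i (i + 1)) (pairPoly K p) =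
      pairPoly K (Equiv.swap i (i + 1) p.1, Equiv.swap i (i + 1) p.2) := by
    intro p; simp [pairPoly]
  have hsw : ∀ a b : ℕ, a < n → b < n → a < b → ¬ (a = i ∧ b = i + 1) →
      Equiv.swap i (i + 1) a < n ∧ Equiv.swap i (i + 1) b < n ∧
        Equiv.swap i (i + 1) a < Equiv.swap i (i + 1) b ∧
        ¬ (Equiv.swap i (i + 1) a = i ∧ Equiv.swap i (i + 1) b = i + 1) := by
    intro a b ha hb hab hne
    simp only [Equiv.swap_apply_def]
    split_ifs <;> omega
  rw [pairPolyProd, ← Finset.mul_prod_erase _ _ hmem, map_mul, map_mul, map_prod, hren, hren]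
  have hS : ∏ p ∈ ((Finset.range n ×ˢ Finset.range n).filter (fun p => p.1 < p.2)).erase (i, i + 1),
      rename (Equiv.swap i (i + 1)) (pairPoly K p) =
      ∏ p ∈ ((Finset.range n ×ˢ Finset.range n).filter (fun p => p.1 < p.2)).erase (i, i + 1),
        pairPoly K p := by
    refine Finset.prod_nbij' (fun p => (Equiv.swap i (i + 1) p.1, Equiv.swap i (i + 1) p.2))
      (fun p => (Equiv.swap i (i + 1) p.1, Equiv.swap i (i + 1) p.2)) ?_ ?_ ?_ ?_ ?_
    · rintro ⟨a, b⟩ h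
      simp only [Finset.mem_erase, Finset.mem_filter, Finset.mem_product, Finset.mem_range,
        ne_eq, Prod.mk.injEq] at h ⊢
      have := hsw a b h.2.1.1 h.2.1.2 h.2.2 h.1
      tauto
    · rintro ⟨a, b⟩ h
      simp only [Finset.mem_erase, Finset.mem_filter, Finset.mem_product, Finset.mem_range,
        ne_eq, Prod.mk.injEq] at h ⊢
      have := hsw a b h.2.1.1 h.2.1.2 h.2.2 h.1
      tauto
    · intro p _; simp
    · intro p _; simp
    · intro p _; exact hren p
  rw [hS]
  simp only [Equiv.swap_apply_left, Equiv.swap_apply_right]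
  ring

/-- The function `ℕ → ℕ` that skips the value `i`. -/
def skip (i j : ℕ) : ℕ := if j < i then j else j + 1

/-- Setting the variable `i` to zero and renumbering the variables above it. -/
noncomputable def skipVar (i : ℕ) : MvPolynomial ℕ K →ₐ[K] MvPolynomial ℕ K :=
  MvPolynomial.aeval fun t => if t < i then X t else if t = i then 0 else X (t - 1)

variable {K}

theorem skipVar_X_skip (i j : ℕ) : skipVar K i (X (skip i j)) = X j := by
  simp only [skipVar, aeval_X, skip]
  split_ifs <;> first | rfl | omega

theorem skipVar_X_self (i : ℕ) : skipVar K i (X i) = 0 := by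
  simp [skipVar]

theorem prod_range_skip {M : Type*} [CommMonoid M] {n i : ℕ} (hi : i ≤ n) (φ : ℕ → M) :
    ∏ s ∈ Finset.range (n + 1), φ s = φ i * ∏ s ∈ Finset.range n, φ (skip i s) := by
  rw [Finset.prod_range, Fin.prod_univ_succAbove _ (⟨i, by omega⟩ : Fin (n + 1)), Finset.prod_range]
  congr 1
  refine Finset.prod_congr rfl fun s _ => ?_
  simp only [Fin.succAbove, skip, Fin.lt_def, Fin.val_castSucc]
  split_ifs <;> simp

/-- At X_i = 0 the pairs (s, i) contribute 1 and the pairs (i, t) contribute 1 + X_t; renumbering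
turns t > i into t - 1 ≥ i. -/
theorem skipVar_pairPolyProd (n : ℕ) : ∀ {i : ℕ}, i ≤ n → skipVar K i (pairPolyProd K (n + 1)) =
    (∏ t ∈ Finset.Ico i n, (X t + 1)) * pairPolyProd K n := by
  induction n with
  | zero => intro i hi; simp [pairPolyProd_eq]
  | succ n ih =>
    intro i hi
    rcases Nat.lt_or_ge n i with h | h
    · obtain rfl : i = n + 1 := by omega
      rw [pairPolyProd_succ, map_mul, map_prod]
      have h1 : ∏ s ∈ Finset.range (n + 1), skipVar K (n + 1) (pairPoly K (s, n + 1)) = 1 := by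
        refine Finset.prod_eq_one fun s _ => ?_
        simp [pairPoly, skipVar_X_self]
      have h2 : skipVar K (n + 1) (pairPolyProd K (n + 1)) = pairPolyProd K (n + 1) := by
        rw [pairPolyProd, map_prod]
        refine Finset.prod_congr rfl fun p hp => ?_
        simp only [Finset.mem_filter, Finset.mem_product, Finset.mem_range] at hp
        simp only [pairPoly, skipVar, map_add, map_mul, map_one, aeval_X, if_pos hp.1.1,
          if_pos hp.1.2]
      rw [h1, h2]
      simp
    · rw [pairPolyProd_succ, map_mul, ih h, map_prod, prod_range_skip h,
        Finset.prod_Ico_succ_top h, pairPolyProd_succ K n]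
      have h0 : skipVar K i (X (n + 1)) = X n := by
        have := skipVar_X_skip (K := K) i n
        rwa [skip, if_neg (by omega)] at this
      have h1 : skipVar K i (pairPoly K (i, n + 1)) = X n + 1 := by
        simp [pairPoly, skipVar_X_self, h0]
      have h2 : ∀ s, skipVar K i (pairPoly K (skip i s, n + 1)) = pairPoly K (s, n) := by
        intro s; simp [pairPoly, skipVar_X_skip, h0]
      simp only [h1, h2]
      ring

end PairPolynomial

/-! ### The determinant, its antiderivative and the Laplace expansion. -/

section Determinant

variable {K : Type*} [Field K]

/-- The determinant of the functions `φ 0, …, φ (n - 1)` in the variables `l 0, …, l (n - 1)`, as a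
function of `l`. -/
def funDet (n : ℕ) (φ : ℕ → ℤ → K) (l : ℕ → ℤ) : K :=
  (Matrix.of fun m j : Fin n => φ j (l m)).det

/-- A determinant is the antisymmetrization of a function in each pair of adjacent variables. -/
theorem exists_funDet_eq_sub_swap {n i : ℕ} (hi : i + 1 < n) (φ : ℕ → ℤ → K) :
    ∃ f : (ℕ → ℤ) → K, ∀ l, funDet n φ l = f l - f (l ∘ Equiv.swap i (i + 1)) := by
  classical
  let u : Fin n := ⟨i, by omega⟩
  let v : Fin n := ⟨i + 1, hi⟩
  have huv : u ≠ v := by simp [u, v]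
  have hval : ∀ m : Fin n, Equiv.swap i (i + 1) (m : ℕ) = (Equiv.swap u v m : Fin n) := by
    intro m
    simp only [Equiv.swap_apply_def, Fin.ext_iff, u, v]
    split_ifs <;> simp_all
  let term : Equiv.Perm (Fin n) → (ℕ → ℤ) → K := fun σ l =>
    ((Equiv.Perm.sign σ : ℤ) : K) * ∏ m : Fin n, φ (σ m) (l m)
  have hterm : ∀ σ l, term (σ * Equiv.swap u v) l = - term σ (l ∘ Equiv.swap i (i + 1)) := by
    intro σ l
    simp only [term, Equiv.Perm.sign_mul, Equiv.Perm.sign_swap huv, Function.comp_apply, hval,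
      Equiv.Perm.mul_apply]
    rw [← Equiv.prod_comp (Equiv.swap u v)
      (fun m => φ (σ m) (l (Equiv.swap u v m : Fin n)))]
    simp
  -- One permutation from each pair {σ, σ ∘ (u v)}. The form f - f ∘ swap forces vanishing on the
  -- diagonal in characteristic 2 as well.
  refine ⟨fun l => ∑ σ with σ u < σ v, term σ l, fun l => ?_⟩
  have h : funDet n φ l = ∑ σ, term σ l := by
    rw [funDet, ← Matrix.det_transpose, Matrix.det_apply']
    simp [term]
  rw [h, ← Finset.sum_filter_add_sum_filter_not _ (fun σ : Equiv.Perm (Fin n) => σ u < σ v),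
    sub_eq_add_neg, ← Finset.sum_neg_distrib]
  congr 1
  refine Finset.sum_nbij' (· * Equiv.swap u v) (· * Equiv.swap u v) ?_ ?_ ?_ ?_ ?_
  · intro σ hσ
    simp only [Finset.mem_filter, Finset.mem_univ, true_and, Equiv.Perm.mul_apply,
      Equiv.swap_apply_left, Equiv.swap_apply_right, not_lt] at hσ ⊢
    exact lt_of_le_of_ne hσ fun h => huv (σ.injective h).symm
  · intro σ hσ
    simp only [Finset.mem_filter, Finset.mem_univ, true_and, Equiv.Perm.mul_apply,
      Equiv.swap_apply_left, Equiv.swap_apply_right, not_lt] at hσ ⊢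
    exact hσ.le
  · intro σ _; simp [mul_assoc]
  · intro σ _; simp [mul_assoc]
  · intro σ _
    have := hterm (σ * Equiv.swap u v) l
    simpa [mul_assoc] using this

theorem diffOp_comp_swap (P : K) (i x : ℕ) (f : (ℕ → ℤ) → K) :
    diffOp P x (LinearMap.funLeft K K (fun l : ℕ → ℤ => l ∘ Equiv.swap i (i + 1)) f) =
      LinearMap.funLeft K K (fun l : ℕ → ℤ => l ∘ Equiv.swap i (i + 1))
        (diffOp P (Equiv.swap i (i + 1) x) f) := by
  ext l
  have h : Function.update l x (l x + 1) ∘ Equiv.swap i (i + 1) =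
      Function.update (l ∘ Equiv.swap i (i + 1)) (Equiv.swap i (i + 1) x) (l x + 1) := by
    rw [Function.update_comp_equiv, Equiv.symm_swap]
  simp [diffOp_apply, LinearMap.funLeft_apply, h]

/-- A symmetric polynomial applied to a determinant vanishes on the diagonal. -/
theorem polyAct_funDet_eq_zero (P : K) {n i : ℕ} (hi : i + 1 < n) (φ : ℕ → ℤ → K)
    {q : MvPolynomial ℕ K} (hq : rename (Equiv.swap i (i + 1)) q = q) {l : ℕ → ℤ}
    (hl : l i = l (i + 1)) : polyAct P ℕ q (funDet n φ) l = 0 := by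
  obtain ⟨f, hf⟩ := exists_funDet_eq_sub_swap hi φ
  have h : funDet n φ = f - LinearMap.funLeft K K (fun l : ℕ → ℤ => l ∘ Equiv.swap i (i + 1)) f :=
    funext hf
  have hl' : l ∘ Equiv.swap i (i + 1) = l := by
    funext x
    simp only [Function.comp_apply, Equiv.swap_apply_def]
    split_ifs with h1 h2
    · rw [h1, hl]
    · rw [h2, hl]
    · rfl
  -- The symmetric `q` commutes with the swap, which fixes `l`, so the two terms cancel.
  rw [h, map_sub, polyAct_intertwine P _ (fun x => X (Equiv.swap i (i + 1) x))]
  · have : (aeval fun x => X (Equiv.swap i (i + 1) x)) q = q := by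
      have h := aeval_rename (R := K) (Equiv.swap i (i + 1)) (X : ℕ → MvPolynomial ℕ K) q
      rw [hq, aeval_X_left_apply] at h
      exact h.symm
    rw [this, Pi.sub_apply, LinearMap.funLeft_apply, hl', sub_self]
  · intro x f
    rw [diffOp_comp_swap, polyAct_X]

/-- A `P`-difference acts on a determinant by acting on a row. -/
theorem diffOp_det (P : K) {n : ℕ} (ψ : Fin n → Fin n → ℤ → K) (i : Fin n) :
    diffOp P (i : ℕ) (fun l => (Matrix.of fun m j : Fin n => ψ m j (l m)).det) =
      fun l => (Matrix.of fun m j : Fin n =>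
        if m = i then P ^ (-l i) * (ψ m j (l m + 1) - ψ m j (l m)) else ψ m j (l m)).det := by
  funext l
  let A : Matrix (Fin n) (Fin n) K := Matrix.of fun m j : Fin n => ψ m j (l m)
  have h1 : (Matrix.of fun m j : Fin n => ψ m j (Function.update l (i : ℕ) (l i + 1) m)) =
      A.updateRow i (fun j => ψ i j (l i + 1)) := by
    ext m j
    rw [Matrix.updateRow_apply]
    by_cases h : m = i
    · subst h; simp
    · simp [h, A, Function.update_of_ne (Fin.val_ne_of_ne h)]
  have h2 : A = A.updateRow i (fun j => ψ i j (l i)) := by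
    ext m j
    rw [Matrix.updateRow_apply]
    split_ifs with h
    · subst h; rfl
    · rfl
  have h3 : (Matrix.of fun m j : Fin n =>
        if m = i then P ^ (-l i) * (ψ m j (l m + 1) - ψ m j (l m)) else ψ m j (l m)) =
      A.updateRow i (P ^ (-l i) • ((fun j => ψ i j (l i + 1)) - fun j => ψ i j (l i))) := by
    ext m j
    rw [Matrix.updateRow_apply]
    by_cases h : m = i
    · subst h; simp
    · simp [h, A]
  rw [diffOp_apply, h1, h3, Matrix.det_updateRow_smul, sub_eq_add_neg (fun j => ψ i j (l i + 1)),
    ← neg_one_smul K fun j => ψ i j (l i), Matrix.det_updateRow_add, Matrix.det_updateRow_smul,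
    ← h2]
  simp only [A]
  ring

/-- The powers `P ^ (m * y)`, divided so that the `P`-difference lowers the index. -/
def divPow (P : K) (m : ℕ) (y : ℤ) : K :=
  (P ^ y) ^ m / ∏ r ∈ Finset.range m, (P ^ (r + 1) - 1)

theorem divPow_zero (P : K) (y : ℤ) : divPow P 0 y = 1 := by simp [divPow]

theorem divPow_diff {P : K} (hP0 : P ≠ 0) {m : ℕ} (hP : P ^ (m + 1) ≠ 1) (y : ℤ) :
    P ^ (-y) * (divPow P (m + 1) (y + 1) - divPow P (m + 1) y) = divPow P m y := by
  have h1 : P ^ (m + 1) - 1 ≠ 0 := sub_ne_zero.mpr hP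
  have h2 : P ^ y ≠ 0 := zpow_ne_zero _ hP0
  have h3 : (P ^ (y + 1)) ^ (m + 1) - (P ^ y) ^ (m + 1) =
      P ^ y * ((P ^ y) ^ m * (P ^ (m + 1) - 1)) := by
    rw [zpow_add_one₀ hP0, mul_pow]; ring
  rw [divPow, divPow, divPow, Finset.prod_range_succ, ← sub_div, h3, zpow_neg, ← mul_div_assoc,
    inv_mul_cancel_left₀ h2, mul_div_mul_right _ _ h1]

/-- The product of the first `r` variables. -/
noncomputable def varProd (K : Type*) [Field K] (r : ℕ) : MvPolynomial ℕ K :=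
  ∏ t ∈ Finset.range r, X t

theorem polyAct_varProd_succ (P : K) (r : ℕ) (f : (ℕ → ℤ) → K) :
    polyAct P ℕ (varProd K (r + 1)) f = diffOp P r (polyAct P ℕ (varProd K r) f) := by
  rw [varProd, Finset.prod_range_succ, mul_comm, polyAct_mul_apply, polyAct_X, varProd]

theorem polyAct_varProd_funDet {P : K} (hP0 : P ≠ 0) {n : ℕ}
    (hP : ∀ m : ℕ, 0 < m → m ≤ n → P ^ m ≠ 1) :
    polyAct P ℕ (varProd K n) (funDet n fun m => divPow P (m + 1)) = funDet n (divPow P) := by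
  have key : ∀ r ≤ n, polyAct P ℕ (varProd K r) (funDet n fun m => divPow P (m + 1)) =
      fun l => (Matrix.of fun m j : Fin n =>
        (if (m : ℕ) < r then divPow P j else divPow P (j + 1)) (l m)).det := by
    intro r
    induction r with
    | zero => intro _; funext l; simp [varProd, funDet]
    | succ r ih =>
      intro hr
      rw [polyAct_varProd_succ, ih (by omega)]
      have := diffOp_det P (fun m j : Fin n =>
        if (m : ℕ) < r then divPow P j else divPow P (j + 1)) ⟨r, hr⟩
      rw [this]
      funext l
      congr 2
      funext m j
      by_cases h : m = ⟨r, hr⟩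
      · subst h
        simp only [lt_irrefl, if_true, if_false, Nat.lt_succ_self]
        exact divPow_diff hP0 (hP _ (by omega) (by omega)) _
      · have h' : (m : ℕ) ≠ r := fun h' => h (Fin.ext h')
        have : (m : ℕ) < r + 1 ↔ (m : ℕ) < r := by omega
        simp only [if_neg h, this]
  rw [key n le_rfl]
  funext l
  simp [funDet]

/-- Laplace expansion along the constant column. -/
theorem funDet_divPow_succ (P : K) (n : ℕ) (l : ℕ → ℤ) :
    funDet (n + 1) (divPow P) l =
      ∑ i ∈ Finset.range (n + 1), (-1) ^ i * funDet n (fun m => divPow P (m + 1)) (l ∘ skip i) := by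
  rw [funDet, Matrix.det_succ_column_zero, Finset.sum_range]
  refine Finset.sum_congr rfl fun i _ => ?_
  simp only [Matrix.of_apply, Fin.val_zero, divPow_zero, mul_one]
  congr 1
  rw [funDet]
  congr 1
  ext m j
  simp only [Matrix.submatrix_apply, Matrix.of_apply, Fin.val_succ, Function.comp_apply]
  congr 2
  simp only [Fin.succAbove, skip, Fin.lt_def, Fin.val_castSucc]
  split_ifs <;> simp

/-- The variable `i` does not occur in `l ∘ skip i`, so its difference is 0; the other differences
are renumbered as in `skipVar`. -/
theorem diffOp_comp_skip (P : K) (i x : ℕ) (f : (ℕ → ℤ) → K) :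
    diffOp P x (LinearMap.funLeft K K (fun l : ℕ → ℤ => l ∘ skip i) f) =
      LinearMap.funLeft K K (fun l : ℕ → ℤ => l ∘ skip i)
        (polyAct P ℕ (if x < i then X x else if x = i then 0 else X (x - 1)) f) := by
  have hinj : Function.Injective (skip i) := by
    intro a b h
    simp only [skip] at h
    split_ifs at h <;> omega
  have hx : x = i ∨ ∃ y, x = skip i y ∧
      (if x < i then X x else if x = i then 0 else X (x - 1) : MvPolynomial ℕ K) = X y := by
    rcases lt_trichotomy x i with h | h | h
    · exact Or.inr ⟨x, by simp [skip, h], by simp [h]⟩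
    · exact Or.inl h
    · exact Or.inr ⟨x - 1, by rw [skip, if_neg (by omega)]; omega,
        by rw [if_neg (by omega), if_neg (by omega)]⟩
  rcases hx with rfl | ⟨y, rfl, hy⟩
  · ext l
    have : Function.update l x (l x + 1) ∘ skip x = l ∘ skip x := by
      refine Function.update_comp_eq_of_notMem_range _ _ ?_
      rintro ⟨a, ha⟩
      simp only [skip] at ha
      split_ifs at ha <;> omega
    simp [diffOp_apply, LinearMap.funLeft_apply, this]
  · rw [hy, polyAct_X]
    ext l
    simp only [diffOp_apply, LinearMap.funLeft_apply, Function.update_comp_eq_of_injective _ hinj,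
      Function.comp_apply]

/-- The polynomial part of the operator formula. -/
noncomputable def operatorFormula (P : K) (n : ℕ) : (ℕ → ℤ) → K :=
  polyAct P ℕ (pairPolyProd K n) (funDet n (divPow P))

/-- The antiderivative of `operatorFormula P n` in all variables. -/
noncomputable def operatorPrimitive (P : K) (n : ℕ) : (ℕ → ℤ) → K :=
  polyAct P ℕ (pairPolyProd K n) (funDet n fun m => divPow P (m + 1))

theorem polyAct_varProd_operatorPrimitive {P : K} (hP0 : P ≠ 0) {n : ℕ}
    (hP : ∀ m : ℕ, 0 < m → m ≤ n → P ^ m ≠ 1) :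
    polyAct P ℕ (varProd K n) (operatorPrimitive P n) = operatorFormula P n := by
  rw [operatorPrimitive, ← polyAct_mul_apply, mul_comm, polyAct_mul_apply,
    polyAct_varProd_funDet hP0 hP, operatorFormula]

theorem polyAct_pairPoly_operatorPrimitive (P : K) {n i : ℕ} (hi : i + 1 < n) {l : ℕ → ℤ}
    (hl : l i = l (i + 1)) :
    polyAct P ℕ (pairPoly K (i + 1, i)) (operatorPrimitive P n) l = 0 := by
  rw [operatorPrimitive, ← polyAct_mul_apply]
  exact polyAct_funDet_eq_zero P hi _ (rename_swap_pairPolyProd K hi) hl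

/-- The i-th Laplace term is free of the variable i, so the operator acts on it through its
specialization at X_i = 0. -/
theorem operatorFormula_succ (P : K) (n : ℕ) (k : ℕ → ℤ) :
    operatorFormula P (n + 1) k = ∑ i ∈ Finset.range (n + 1), (-1) ^ i *
      polyAct P ℕ (∏ t ∈ Finset.Ico i n, (X t + 1)) (operatorPrimitive P n) (k ∘ skip i) := by
  have h : funDet (n + 1) (divPow P) = ∑ i ∈ Finset.range (n + 1), ((-1 : K) ^ i) •
      LinearMap.funLeft K K (fun l : ℕ → ℤ => l ∘ skip i)
        (funDet n fun m => divPow P (m + 1)) := by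
    funext l
    rw [funDet_divPow_succ, Finset.sum_apply]
    rfl
  rw [operatorFormula, h, map_sum, Finset.sum_apply]
  refine Finset.sum_congr rfl fun i hi => ?_
  rw [map_smul, Pi.smul_apply, smul_eq_mul,
    polyAct_intertwine P _ _ (diffOp_comp_skip P i), ← skipVar,
    skipVar_pairPolyProd n (by simpa [Nat.lt_succ_iff] using hi), polyAct_mul_apply]
  rfl

end Determinant

/-! ### Weighted summation over one row. -/

section RowSum

variable {K : Type*} [Field K]

/-- The weight of the entry `y` in position `j` of a row above the row `k`, where `l` holds the
entries to its left. -/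
def entryWeight (P : K) (k : ℕ → ℤ) (j : ℕ) (l : ℕ → ℤ) (y : ℤ) : K :=
  -- Weight zero for rows violating the strict condition lets the sum run over all interlacing rows.
  if 0 < j ∧ ¬ l (j - 1) < k (j + 1) then 0
  else if y < k (j + 1) then P ^ y - if 0 < j ∧ y = l (j - 1) then 1 else 0 else 1

/-- Weighted summation over the entry in position `j` of a row above the row `k`. -/
noncomputable def entrySum (P : K) (k : ℕ → ℤ) (j : ℕ) (f : (ℕ → ℤ) → K) (l : ℕ → ℤ) : K :=
  ∑ y ∈ Finset.Icc (k j) (k (j + 1)), entryWeight P k j l y * f (Function.update l j y)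

/-- Evaluation of the entry in position `j` at its right neighbour below, including that summand. -/
def rightOp (P : K) (k : ℕ → ℤ) (j : ℕ) (f : (ℕ → ℤ) → K) : (ℕ → ℤ) → K :=
  evalOp K j (k (j + 1)) (f + diffOp P j f)

/-- Evaluation of the entry in position `j` at its left neighbour below, with a sign. -/
def leftOp (K : Type*) [Field K] (k : ℕ → ℤ) (j : ℕ) (f : (ℕ → ℤ) → K) : (ℕ → ℤ) → K :=
  -evalOp K j (k j) f

/-- The first `r` entries of `l` interlace with `k`. -/
def Interlaces (k : ℕ → ℤ) (r : ℕ) (l : ℕ → ℤ) : Prop := ∀ i < r, k i ≤ l i ∧ l i ≤ k (i + 1)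

/-- Three consecutive entries among the first `r` are equal. -/
def HasTriple (r : ℕ) (l : ℕ → ℤ) : Prop := ∃ i, i + 2 < r ∧ l i = l (i + 1) ∧ l (i + 1) = l (i + 2)

/-- The vanishing on the diagonals in the first `m` variables that a symmetric operator applied to
an alternating function has. -/
def DiagonalVanishing (P : K) (m : ℕ) (f : (ℕ → ℤ) → K) : Prop :=
  ∀ i, i + 1 < m → ∀ l : ℕ → ℤ, l i = l (i + 1) → polyAct P ℕ (pairPoly K (i + 1, i)) f l = 0

theorem Interlaces.update {k : ℕ → ℤ} {r : ℕ} {l : ℕ → ℤ} (h : Interlaces k r l) {y : ℤ}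
    (h1 : k r ≤ y) (h2 : y ≤ k (r + 1)) : Interlaces k (r + 1) (Function.update l r y) := by
  intro i hi
  rcases eq_or_ne i r with rfl | hne
  · simp [h1, h2]
  · rw [Function.update_of_ne hne]
    exact h i (by omega)

theorem HasTriple.update {r : ℕ} {l : ℕ → ℤ} (h : HasTriple r l) (y : ℤ) :
    HasTriple (r + 1) (Function.update l r y) := by
  obtain ⟨i, hi, h1, h2⟩ := h
  refine ⟨i, by omega, ?_⟩
  rw [Function.update_of_ne (by omega), Function.update_of_ne (by omega),
    Function.update_of_ne (by omega)]
  exact ⟨h1, h2⟩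

theorem DiagonalVanishing.mono {P : K} {m m' : ℕ} (h : m' ≤ m) {f : (ℕ → ℤ) → K}
    (hf : DiagonalVanishing P m f) : DiagonalVanishing P m' f :=
  fun i hi => hf i (by omega)

theorem DiagonalVanishing.add {P : K} {m : ℕ} {f g : (ℕ → ℤ) → K}
    (hf : DiagonalVanishing P m f) (hg : DiagonalVanishing P m g) :
    DiagonalVanishing P m (f + g) := by
  intro i hi l hl
  rw [map_add, Pi.add_apply, hf i hi l hl, hg i hi l hl, add_zero]

theorem DiagonalVanishing.neg {P : K} {m : ℕ} {f : (ℕ → ℤ) → K}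
    (hf : DiagonalVanishing P m f) : DiagonalVanishing P m (-f) := by
  intro i hi l hl
  rw [map_neg, Pi.neg_apply, hf i hi l hl, neg_zero]

theorem DiagonalVanishing.evalOp {P : K} {m : ℕ} {f : (ℕ → ℤ) → K} {j : ℕ} (hj : m ≤ j)
    (hf : DiagonalVanishing P m f) (c : ℤ) : DiagonalVanishing P m (evalOp K j c f) := by
  intro i hi l hl
  rw [polyAct_evalOp, evalOp_apply]
  · refine hf i hi _ ?_
    rw [Function.update_of_ne (by omega), Function.update_of_ne (by omega), hl]
  · simp only [pairPoly, map_add, map_mul, map_one]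
    rw [killVar_X_of_ne (by omega), killVar_X_of_ne (by omega)]

theorem DiagonalVanishing.diffOp {P : K} {m : ℕ} {f : (ℕ → ℤ) → K} {j : ℕ} (hj : m ≤ j)
    (hf : DiagonalVanishing P m f) : DiagonalVanishing P m (diffOp P j f) := by
  intro i hi l hl
  rw [← polyAct_X, ← polyAct_mul_apply, mul_comm, polyAct_mul_apply, polyAct_X, diffOp_apply,
    hf i hi l hl, hf i hi _ (by
      rw [Function.update_of_ne (by omega), Function.update_of_ne (by omega), hl])]
  simp

theorem DiagonalVanishing.rightOp {P : K} {m : ℕ} {f : (ℕ → ℤ) → K} {j : ℕ} (hj : m ≤ j)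
    (hf : DiagonalVanishing P m f) (k : ℕ → ℤ) : DiagonalVanishing P m (rightOp P k j f) :=
  (hf.add (hf.diffOp hj)).evalOp hj _

theorem DiagonalVanishing.leftOp {P : K} {m : ℕ} {f : (ℕ → ℤ) → K} {j : ℕ} (hj : m ≤ j)
    (hf : DiagonalVanishing P m f) (k : ℕ → ℤ) : DiagonalVanishing P m (leftOp K k j f) :=
  (hf.evalOp hj _).neg

theorem killVar_varProd {r j : ℕ} (h : r ≤ j) : killVar K j (varProd K r) = varProd K r := by
  rw [varProd, map_prod]
  refine Finset.prod_congr rfl fun t ht => killVar_X_of_ne ?_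
  have := Finset.mem_range.mp ht
  omega

theorem polyAct_varProd_vanishing (P : K) (i : ℕ) {f : (ℕ → ℤ) → K}
    (hf : ∀ l : ℕ → ℤ, l i = l (i + 1) → f l = 0) (r : ℕ) (hr : r ≤ i) {l : ℕ → ℤ}
    (hl : l i = l (i + 1)) : polyAct P ℕ (varProd K r) f l = 0 := by
  induction r generalizing l with
  | zero => simpa [varProd] using hf l hl
  | succ r ih =>
    rw [polyAct_varProd_succ, diffOp_apply, ih (by omega) hl, ih (by omega) (by
      rw [Function.update_of_ne (by omega), Function.update_of_ne (by omega), hl])]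
    simp

/-! ### Summation of the entries from right to left. -/

/-- The partial row sum `A` over the entries in positions `≥ r` is expressed in terms of `R` and `H`,
the antiderivatives of the part in which all these entries are evaluated at their right neighbours
and of the preceding stage. -/
structure PartialSum (P : K) (k : ℕ → ℤ) (r : ℕ) (A R H : (ℕ → ℤ) → K) : Prop where
  eq : ∀ l, Interlaces k r l → A l = polyAct P ℕ (varProd K r) (R + leftOp K k r H) l -
    if 0 < r ∧ l (r - 1) = k r then
      polyAct P ℕ (varProd K (r + 1)) H (Function.update l r (k r)) else 0
  diag_right : DiagonalVanishing P r R
  diag : DiagonalVanishing P (r + 1) H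
  triple_succ : ∀ l, Interlaces k r l → HasTriple (r + 1) (Function.update l r (k r)) →
    polyAct P ℕ (varProd K (r + 1)) H (Function.update l r (k r)) = 0
  triple : ∀ l, Interlaces k r l → HasTriple r l →
    polyAct P ℕ (varProd K r) (R + leftOp K k r H) l = 0

theorem polyAct_varProd_rightOp (P : K) (k : ℕ → ℤ) (r : ℕ) (f : (ℕ → ℤ) → K) (l : ℕ → ℤ) :
    polyAct P ℕ (varProd K r) (rightOp P k r f) l =
      polyAct P ℕ (varProd K r) f (Function.update l r (k (r + 1))) +
        polyAct P ℕ (varProd K (r + 1)) f (Function.update l r (k (r + 1))) := by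
  rw [rightOp, polyAct_evalOp _ _ _ (killVar_varProd le_rfl), evalOp_apply, map_add, Pi.add_apply,
    ← polyAct_X, ← polyAct_mul_apply, varProd, varProd, Finset.prod_range_succ]

theorem polyAct_varProd_leftOp (P : K) (k : ℕ → ℤ) {r j : ℕ} (h : r ≤ j) (f : (ℕ → ℤ) → K)
    (l : ℕ → ℤ) :
    polyAct P ℕ (varProd K r) (leftOp K k j f) l =
      -polyAct P ℕ (varProd K r) f (Function.update l j (k j)) := by
  rw [leftOp, map_neg, polyAct_evalOp _ _ _ (killVar_varProd h)]
  rfl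

/-- The sum over an entry without the correction for equality with its left neighbour. -/
theorem PartialSum.sum_eq {P : K} (hP : P ≠ 0) {k : ℕ → ℤ} {r : ℕ} (hk : k r ≤ k (r + 1))
    {A R H : (ℕ → ℤ) → K} (h : PartialSum P k (r + 1) A R H) {l : ℕ → ℤ}
    (hl : Interlaces k r l) :
    ∑ y ∈ Finset.Ico (k r) (k (r + 1)), P ^ y * A (Function.update l r y) +
      A (Function.update l r (k (r + 1))) =
    polyAct P ℕ (varProd K r) (rightOp P k r R + leftOp K k r (R + leftOp K k (r + 1) H)) l := by
  have h1 : ∀ y ∈ Finset.Ico (k r) (k (r + 1)), P ^ y * A (Function.update l r y) =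
      P ^ y * diffOp P r (polyAct P ℕ (varProd K r) (R + leftOp K k (r + 1) H))
        (Function.update l r y) := by
    intro y hy
    rw [Finset.mem_Ico] at hy
    rw [h.eq _ (hl.update hy.1 hy.2.le), if_neg, sub_zero, polyAct_varProd_succ]
    simp only [Nat.add_sub_cancel, Function.update_self]
    omega
  -- Only at the right end y = k (r + 1) is the correction term of `A` present.
  have h2 := h.eq _ (hl.update hk le_rfl)
  rw [if_pos (by simp)] at h2
  rw [Finset.sum_congr rfl h1, sum_Ico_diffOp hP _ _ _ hk, h2]
  simp only [map_add, Pi.add_apply, polyAct_varProd_rightOp]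
  rw [polyAct_varProd_leftOp P k le_rfl, polyAct_varProd_leftOp P k le_rfl, map_add, Pi.add_apply,
    polyAct_varProd_leftOp P k (Nat.le_succ r), polyAct_varProd_leftOp P k (Nat.le_succ r)]
  have h3 := polyAct_varProd_vanishing P r (h.diag r (by omega)) r le_rfl
    (l := Function.update (Function.update l r (k (r + 1))) (r + 1) (k (r + 1)))
    (by rw [Function.update_self, Function.update_of_ne (by omega), Function.update_self])
  -- The three summands are the `H`-terms at the right end: from the correction-free part of `A`,
  -- from telescoping, and from the correction. Together they vanish on the diagonal.
  have h4 : varProd K r * pairPoly K (r + 1, r) =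
      varProd K (r + 1) + varProd K r + varProd K (r + 1 + 1) := by
    simp only [varProd, pairPoly, Finset.prod_range_succ]
    ring
  rw [← polyAct_mul_apply, h4, map_add, map_add, LinearMap.add_apply, LinearMap.add_apply,
    Pi.add_apply, Pi.add_apply] at h3
  linear_combination -h3

/-- By interlacing l (r - 1) ≤ k r ≤ y, so the Iverson bracket can only fire at y = k r = l (r - 1).
Its contribution, minus the value of `A` there, is the new correction term. -/
theorem PartialSum.step {P : K} (hP : P ≠ 0) {k : ℕ → ℤ} {r : ℕ} (hk : k r ≤ k (r + 1))
    {A R H : (ℕ → ℤ) → K} (h : PartialSum P k (r + 1) A R H) :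
    PartialSum P k r (entrySum P k r A) (rightOp P k r R) (R + leftOp K k (r + 1) H) where
  eq l hl := by
    rw [← h.sum_eq hP hk hl]
    have hIcc : Finset.Icc (k r) (k (r + 1)) = insert (k (r + 1)) (Finset.Ico (k r) (k (r + 1))) :=
      by ext; simp only [Finset.mem_Icc, Finset.mem_insert, Finset.mem_Ico]; omega
    rw [entrySum]
    by_cases hc : 0 < r ∧ l (r - 1) = k r
    · rw [if_pos hc]
      have hA := h.eq _ (hl.update le_rfl hk)
      rw [Nat.add_sub_cancel, Function.update_self] at hA
      rcases hk.lt_or_eq with hlt | heq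
      · rw [if_neg (by omega), sub_zero] at hA
        rw [← hA, hIcc, Finset.sum_insert (by simp)]
        have hmem : k r ∈ Finset.Ico (k r) (k (r + 1)) := by simpa using hlt
        rw [← Finset.add_sum_erase _ _ hmem, ← Finset.add_sum_erase _ _ hmem]
        have hw1 : entryWeight P k r l (k (r + 1)) = 1 := by
          rw [entryWeight, if_neg (by omega), if_neg (by omega)]
        have hw2 : entryWeight P k r l (k r) = P ^ k r - 1 := by
          rw [entryWeight, if_neg (by omega), if_pos (by omega), if_pos (by omega)]
        have hw3 : ∀ y ∈ (Finset.Ico (k r) (k (r + 1))).erase (k r),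
            entryWeight P k r l y * A (Function.update l r y) =
              P ^ y * A (Function.update l r y) := by
          intro y hy
          rw [Finset.mem_erase, Finset.mem_Ico] at hy
          rw [entryWeight, if_neg (by omega), if_pos (by omega), if_neg (by omega), sub_zero]
        rw [hw1, hw2, Finset.sum_congr rfl hw3]
        ring
      -- Now l (r - 1) = k r = k (r + 1), so the only entry has weight 0. Vanishing on triples
      -- removes the old correction from `A`, and the new one then cancels the sum.
      · rw [if_pos (by omega)] at hA
        have ht := h.triple_succ (Function.update l r (k r)) (hl.update le_rfl hk)
          ⟨r - 1, by omega, by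
            rw [Nat.sub_add_cancel hc.1, show r - 1 + 2 = r + 1 by omega, Function.update_self,
              Function.update_of_ne (by omega), Function.update_of_ne (by omega),
              Function.update_of_ne (by omega), Function.update_self]
            exact ⟨hc.2, heq⟩⟩
        rw [ht, sub_zero] at hA
        rw [← hA, ← heq, Finset.Ico_self, Finset.sum_empty, Finset.Icc_self, Finset.sum_singleton,
          entryWeight, if_pos (by omega)]
        ring
    · rw [if_neg hc, sub_zero, hIcc, Finset.sum_insert (by simp), add_comm]
      have hle : 0 < r → l (r - 1) < k r := by
        intro hr
        have := (hl (r - 1) (by omega)).2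
        rw [Nat.sub_add_cancel hr] at this
        omega
      congr 1
      · refine Finset.sum_congr rfl fun y hy => ?_
        rw [Finset.mem_Ico] at hy
        rw [entryWeight, if_neg (by omega), if_pos (by omega), if_neg (by omega), sub_zero]
      · rw [entryWeight, if_neg (by omega), if_neg (by omega), one_mul]
  diag_right := (h.diag_right.mono (by omega)).rightOp le_rfl k
  diag := h.diag_right.add ((h.diag.mono (by omega)).leftOp le_rfl k)
  triple_succ l hl ht := h.triple _ (hl.update le_rfl hk) ht
  triple l hl ht := by
    have hA : ∀ y, k r ≤ y → y ≤ k (r + 1) → A (Function.update l r y) = 0 := by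
      intro y h1 h2
      rw [h.eq _ (hl.update h1 h2), h.triple _ (hl.update h1 h2) (ht.update y),
        h.triple_succ _ (hl.update h1 h2) ((ht.update y).update _)]
      simp
    rw [← h.sum_eq hP hk hl, hA _ hk le_rfl, add_zero]
    refine Finset.sum_eq_zero fun y hy => ?_
    rw [Finset.mem_Ico] at hy
    rw [hA y hy.1 hy.2.le, mul_zero]

open Classical in
/-- The rows of length `r` that interlace with `k`, extended by zero. -/
noncomputable def rowsAbove (k : ℕ → ℤ) : ℕ → Finset (ℕ → ℤ)
  | 0 => {0}
  | r + 1 => (rowsAbove k r ×ˢ Finset.Icc (k r) (k (r + 1))).image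
      fun p => Function.update p.1 r p.2

theorem mem_rowsAbove {k : ℕ → ℤ} {r : ℕ} {l : ℕ → ℤ} :
    l ∈ rowsAbove k r ↔ Interlaces k r l ∧ ∀ j, r ≤ j → l j = 0 := by
  induction r generalizing l with
  | zero =>
    simp only [rowsAbove, Finset.mem_singleton, Interlaces, Nat.not_lt_zero, false_imp_iff,
      implies_true, true_and, Nat.zero_le, true_imp_iff]
    exact funext_iff
  | succ r ih =>
    simp only [rowsAbove, Finset.mem_image, Finset.mem_product, Prod.exists, ih, Finset.mem_Icc]
    constructor
    · rintro ⟨l, y, ⟨⟨h1, h2⟩, h3, h4⟩, rfl⟩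
      refine ⟨h1.update h3 h4, fun j hj => ?_⟩
      rw [Function.update_of_ne (by omega)]
      exact h2 j (by omega)
    · rintro ⟨h1, h2⟩
      refine ⟨Function.update l r 0, l r, ⟨⟨fun i hi => ?_, fun j hj => ?_⟩, h1 r (by omega)⟩, ?_⟩
      · rw [Function.update_of_ne (by omega)]
        exact h1 i (by omega)
      · rcases eq_or_ne j r with rfl | hne
        · simp
        · rw [Function.update_of_ne hne]
          exact h2 j (by omega)
      · simp

theorem sum_rowsAbove_succ (k : ℕ → ℤ) (r : ℕ) (f : (ℕ → ℤ) → K) :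
    ∑ l ∈ rowsAbove k (r + 1), f l =
      ∑ l ∈ rowsAbove k r, ∑ y ∈ Finset.Icc (k r) (k (r + 1)), f (Function.update l r y) := by
  classical
  rw [rowsAbove, Finset.sum_image, Finset.sum_product]
  rintro ⟨l, y⟩ h ⟨l', y'⟩ h' heq
  simp only [Finset.coe_product, Set.mem_prod, Finset.mem_coe, mem_rowsAbove] at h h' heq
  have hy : y = y' := by simpa using congrFun heq r
  refine Prod.ext (funext fun j => ?_) hy
  rcases eq_or_ne j r with rfl | hne
  · exact (h.1.2 j le_rfl).trans (h'.1.2 j le_rfl).symm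
  · simpa [hne] using congrFun heq j

/-- The weight of the row `l` of length `r` above the row `k`. -/
def rowWeight (P : K) (k : ℕ → ℤ) (r : ℕ) (l : ℕ → ℤ) : K :=
  ∏ j ∈ Finset.range r, entryWeight P k j l (l j)

theorem sum_rowWeight_succ (P : K) (k : ℕ → ℤ) (r : ℕ) (f : (ℕ → ℤ) → K) :
    ∑ l ∈ rowsAbove k (r + 1), rowWeight P k (r + 1) l * f l =
      ∑ l ∈ rowsAbove k r, rowWeight P k r l * entrySum P k r f l := by
  rw [sum_rowsAbove_succ]
  refine Finset.sum_congr rfl fun l _ => ?_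
  rw [entrySum, Finset.mul_sum]
  refine Finset.sum_congr rfl fun y _ => ?_
  have h1 : ∀ j ≤ r, entryWeight P k j (Function.update l r y) = entryWeight P k j l := by
    intro j hj
    funext z
    rcases Nat.eq_zero_or_pos j with rfl | hj'
    · simp [entryWeight]
    · rw [entryWeight, entryWeight, Function.update_of_ne (by omega)]
  rw [rowWeight, Finset.prod_range_succ, h1 r le_rfl, Function.update_self, rowWeight, mul_assoc]
  congr 1
  refine Finset.prod_congr rfl fun j hj => ?_
  have := Finset.mem_range.mp hj
  rw [h1 j this.le, Function.update_of_ne (by omega)]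

/-- The entries at positions `< i` are `k 0, …, k (i - 1)` and those in positions `i ≤ j < r` are
`k (i + 1), …, k r`; the others are taken from `l`. -/
def skipRow (k : ℕ → ℤ) (i r : ℕ) (l : ℕ → ℤ) (j : ℕ) : ℤ := if j < r then k (skip i j) else l j

/-- Unrolling `PartialSum.step` leaves only choices in which the entries before some position i sit
at their left ends, with sign -1 each, and the others at their right ends, with operator 1 + X_t.
Such a row is k with k_i deleted. -/
theorem PartialSum.sum_rowWeight {P : K} (hP : P ≠ 0) {k : ℕ → ℤ} {r : ℕ}
    (hk : ∀ j < r, k j ≤ k (j + 1)) {A R H : (ℕ → ℤ) → K} (h : PartialSum P k r A R H) :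
    ∑ l ∈ rowsAbove k r, rowWeight P k r l * A l =
      (-1) ^ (r + 1) * H (skipRow k (r + 1) (r + 1) 0) + ∑ i ∈ Finset.range (r + 1), (-1) ^ i *
        polyAct P ℕ (∏ t ∈ Finset.Ico i r, (X t + 1)) R (skipRow k i r 0) := by
  induction r generalizing A R H with
  | zero =>
    have h0 : skipRow k 0 0 0 = 0 := by funext j; simp [skipRow]
    have h1 : skipRow k 1 1 0 = Function.update (0 : ℕ → ℤ) 0 (k 0) := by
      funext j
      rcases Nat.eq_zero_or_pos j with rfl | hj
      · simp [skipRow, skip]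
      · rw [Function.update_of_ne (by omega), skipRow, if_neg (by omega)]
    have := h.eq 0 (by intro i hi; omega)
    simp [rowsAbove, rowWeight, this, varProd, leftOp, evalOp_apply, h0, h1]
    ring
  | succ r ih =>
    rw [sum_rowWeight_succ, ih (fun j hj => hk j (by omega)) (h.step hP (hk r (by omega))),
      Finset.sum_range_succ _ (r + 1)]
    have h1 : ∀ i ∈ Finset.range (r + 1), (-1) ^ i *
        polyAct P ℕ (∏ t ∈ Finset.Ico i r, (X t + 1)) (rightOp P k r R) (skipRow k i r 0) =
        (-1) ^ i * polyAct P ℕ (∏ t ∈ Finset.Ico i (r + 1), (X t + 1)) R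
          (skipRow k i (r + 1) 0) := by
      intro i hi
      have hi' : i ≤ r := Nat.lt_succ_iff.mp (Finset.mem_range.mp hi)
      have h2 : skipRow k i (r + 1) 0 = Function.update (skipRow k i r 0) r (k (r + 1)) := by
        funext j
        rcases eq_or_ne j r with rfl | hne
        · rw [Function.update_self, skipRow, if_pos (by omega), skip, if_neg (by omega)]
        · rw [Function.update_of_ne hne, skipRow, skipRow]
          congr 1
          exact propext (by omega)
      have h3 : killVar K r (∏ t ∈ Finset.Ico i r, (X t + 1)) =
          ∏ t ∈ Finset.Ico i r, (X t + 1) := by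
        rw [map_prod]
        refine Finset.prod_congr rfl fun t ht => ?_
        have := Finset.mem_Ico.mp ht
        rw [map_add, map_one, killVar_X_of_ne (by omega)]
      rw [rightOp, polyAct_evalOp _ _ _ h3, evalOp_apply, h2, Finset.prod_Ico_succ_top hi',
        polyAct_mul_apply, map_add (polyAct P ℕ), polyAct_X, map_one, LinearMap.add_apply,
        Module.End.one_apply, add_comm R]
    have h4 : skipRow k (r + 1 + 1) (r + 1 + 1) 0 =
        Function.update (skipRow k (r + 1) (r + 1) 0) (r + 1) (k (r + 1)) := by
      funext j
      rcases eq_or_ne j (r + 1) with rfl | hne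
      · simp [skipRow, skip]
      · rw [Function.update_of_ne hne, skipRow, skipRow]
        by_cases hj : j < r + 1
        · rw [if_pos hj, if_pos (by omega), skip, skip, if_pos hj, if_pos (by omega)]
        · rw [if_neg hj, if_neg (by omega)]
    rw [Finset.sum_congr rfl h1, h4, Finset.Ico_self, Finset.prod_empty, map_one,
      Module.End.one_apply, Pi.add_apply, leftOp, Pi.neg_apply, evalOp_apply]
    ring

/-- Functions that agree whenever the first `n` variables agree. -/
def DependsOnFirst (n : ℕ) (f : (ℕ → ℤ) → K) : Prop :=
  ∀ l l', (∀ j < n, l j = l' j) → f l = f l'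

theorem DependsOnFirst.polyAct {n : ℕ} {f : (ℕ → ℤ) → K} (hf : DependsOnFirst n f) (P : K)
    (q : MvPolynomial ℕ K) : DependsOnFirst n (polyAct P ℕ q f) := by
  induction q using MvPolynomial.induction_on generalizing f with
  | C a =>
    intro l l' h
    rw [← MvPolynomial.algebraMap_eq, AlgHom.commutes]
    simp [Module.algebraMap_end_apply, hf l l' h]
  | add p q hp hq =>
    intro l l' h
    rw [map_add, LinearMap.add_apply, Pi.add_apply, Pi.add_apply, hp hf l l' h, hq hf l l' h]
  | mul_X p x hp =>
    rw [polyAct_mul_apply]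
    refine hp fun l l' h => ?_
    rw [polyAct_X, diffOp_apply, diffOp_apply]
    by_cases hx : x < n
    · rw [h x hx, hf l l' h, hf (Function.update l x (l' x + 1)) (Function.update l' x (l' x + 1))]
      intro j hj
      rcases eq_or_ne j x with rfl | hne
      · simp
      · simp [hne, h j hj]
    · have h' : ∀ l : ℕ → ℤ, f (Function.update l x (l x + 1)) = f l := by
        intro l
        refine hf _ _ fun j hj => ?_
        rw [Function.update_of_ne (by omega)]
      rw [h', h', sub_self, sub_self, mul_zero, mul_zero]

theorem dependsOnFirst_funDet (n : ℕ) (φ : ℕ → ℤ → K) : DependsOnFirst n (funDet n φ) := by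
  intro l l' h
  rw [funDet, funDet]
  congr 2
  funext m j
  rw [h m m.2]

/-- The operator formula satisfies the recursion given by the bottom row. -/
theorem sum_rowWeight_operatorFormula {P : K} (hP0 : P ≠ 0) {n : ℕ}
    (hP : ∀ m : ℕ, 0 < m → m ≤ n → P ^ m ≠ 1) {k : ℕ → ℤ} (hk : ∀ j < n, k j ≤ k (j + 1))
    (htriple : ∀ l, Interlaces k n l → HasTriple n l → operatorFormula P n l = 0) :
    ∑ l ∈ rowsAbove k n, rowWeight P k n l * operatorFormula P n l =
      operatorFormula P (n + 1) k := by
  -- Before any summation there is no preceding stage, so H = 0.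
  have h : PartialSum P k n (operatorFormula P n) (operatorPrimitive P n) 0 := by
    have h0 : leftOp K k n 0 = 0 := by simp [leftOp]
    constructor
    · intro l _
      rw [h0, add_zero, polyAct_varProd_operatorPrimitive hP0 hP]
      simp
    · exact fun i hi l hl => polyAct_pairPoly_operatorPrimitive P hi hl
    · intro i _ l _
      simp
    · simp
    · rwa [h0, add_zero, polyAct_varProd_operatorPrimitive hP0 hP]
  rw [h.sum_rowWeight hP0 hk, operatorFormula_succ, Pi.zero_apply, mul_zero, zero_add]
  refine Finset.sum_congr rfl fun i _ => ?_
  congr 1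
  -- `skipRow k i n 0` and `k ∘ skip i` agree only in the first `n` places.
  refine ((dependsOnFirst_funDet n _).polyAct P _).polyAct P _ _ _ fun j hj => ?_
  rw [skipRow, if_pos hj, Function.comp_apply]

end RowSum

/-! ### Triangles built row by row, and the induction. -/

section Triangles

/-- The weak monotone triangles with `n` rows whose bottom row is `k 0, …, k (n - 1)`. -/
def trianglesAbove (n : ℕ) (k : ℕ → ℤ) : Set (ℕ → ℕ → ℤ) :=
  {a | IsWeakMonotoneTriangle n a ∧ ∀ j < n, a 1 (j + 1) = k j}

/-- The triangle with `n + 1` rows obtained from `b` by adding the bottom row `k`. -/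
def addRow (n : ℕ) (k : ℕ → ℤ) (b : ℕ → ℕ → ℤ) : ℕ → ℕ → ℤ
  | 0, _ => 0
  | 1, 0 => 0
  | 1, j + 1 => if j ≤ n then k j else 0
  | _ + 2, 0 => 0
  | i + 2, j + 1 => b (i + 1) j

/-- The triangle obtained from `a` by deleting the bottom row. -/
def dropRow (a : ℕ → ℕ → ℤ) (i j : ℕ) : ℤ := if i = 0 then 0 else a (i + 1) (j + 1)

/-- The strict inequalities between a row `l` and the row `k` below it. -/
def StrictAbove (k : ℕ → ℤ) (n : ℕ) (l : ℕ → ℤ) : Prop := ∀ j < n, 0 < j → l (j - 1) < k (j + 1)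

theorem addRow_mem {n : ℕ} {k l : ℕ → ℤ} (hl : Interlaces k n l) (hs : StrictAbove k n l)
    {b : ℕ → ℕ → ℤ} (hb : b ∈ trianglesAbove n l) : addRow n k b ∈ trianglesAbove (n + 1) k := by
  obtain ⟨hb, hbl⟩ := hb
  refine ⟨⟨⟨?_, ?_, ?_⟩, ?_⟩, ?_⟩
  · rintro (_ | _ | i) (_ | j) h1 h2 h3
    any_goals omega
    · simp only [addRow, zero_add, if_pos (show j ≤ n by omega)]
      rw [hbl j (by omega)]
      exact (hl j (by omega)).1
    · simp only [addRow]
      exact hb.le_northeast (i + 1) j (by omega) (by omega) (by omega)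
  · rintro (_ | _ | _ | i) (_ | j) h1 h2 h3
    any_goals omega
    · obtain ⟨j, rfl⟩ : ∃ j', j = j' + 1 := ⟨j - 1, by omega⟩
      simp only [addRow, zero_add, Nat.add_one_sub_one, if_pos (show j + 1 ≤ n by omega)]
      rw [hbl j (by omega)]
      exact (hl j (by omega)).2
    · simp only [addRow, Nat.add_one_sub_one]
      exact hb.le_southeast (i + 2) j (by omega) (by omega) (by omega)
  · rintro (_ | _ | i) (_ | j) h
    all_goals simp only [addRow]
    · rw [if_neg (by omega)]
    · exact hb.zero_outside _ _ (by omega)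
  · rintro (_ | _ | _ | i) (_ | _ | j) h1 h2 h3
    any_goals omega
    · obtain ⟨j, rfl⟩ : ∃ j', j = j' + 1 := ⟨j - 1, by omega⟩
      simp only [addRow, zero_add, Nat.add_one_sub_one, if_pos (show j + 1 + 1 ≤ n by omega)]
      rw [hbl j (by omega)]
      exact hs (j + 1) (by omega) (by omega)
    · simp only [addRow, Nat.add_one_sub_one]
      exact hb.lt_of_ne_bottom (i + 2) (j + 1) (by omega) (by omega) (by omega)
  · intro j hj
    simp only [addRow, if_pos (show j ≤ n by omega)]

theorem exists_addRow_eq {n : ℕ} {k : ℕ → ℤ} {a : ℕ → ℕ → ℤ}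
    (ha : a ∈ trianglesAbove (n + 1) k) :
    ∃ l ∈ rowsAbove k n, StrictAbove k n l ∧ ∃ b ∈ trianglesAbove n l, addRow n k b = a := by
  obtain ⟨ha, hk⟩ := ha
  refine ⟨fun j => if j < n then a 2 (j + 2) else 0, ?_, ?_, dropRow a, ⟨⟨⟨?_, ?_, ?_⟩, ?_⟩, ?_⟩, ?_⟩
  · refine mem_rowsAbove.mpr ⟨fun j hj => ?_, fun j hj => by rw [if_neg (by omega)]⟩
    simp only [if_pos hj]
    rw [← hk j (by omega), ← hk (j + 1) (by omega)]
    exact ⟨ha.le_northeast 1 (j + 1) (by omega) (by omega) (by omega),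
      ha.le_southeast 2 (j + 2) (by omega) (by omega) (by omega)⟩
  · rintro (_ | j) hj h0
    · omega
    · simp only [Nat.add_one_sub_one, if_pos (show j < n by omega)]
      rw [← hk (j + 1 + 1) (by omega)]
      exact ha.lt_of_ne_bottom 2 (j + 3) (by omega) (by omega) (by omega)
  · intro i j h1 h2 h3
    rw [dropRow, dropRow, if_neg (by omega), if_neg (by omega)]
    exact ha.le_northeast (i + 1) (j + 1) (by omega) (by omega) (by omega)
  · rintro (_ | _ | i) j h1 h2 h3
    any_goals omega
    rw [dropRow, dropRow, if_neg (by omega), if_neg (by omega)]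
    exact ha.le_southeast (i + 3) (j + 1) (by omega) (by omega) (by omega)
  · intro i j h
    rw [dropRow]
    split_ifs with h0
    · rfl
    · exact ha.zero_outside _ _ (by omega)
  · rintro (_ | _ | i) (_ | j) h1 h2 h3
    any_goals omega
    rw [dropRow, dropRow, if_neg (by omega), if_neg (by omega)]
    exact ha.lt_of_ne_bottom (i + 3) (j + 2) (by omega) (by omega) (by omega)
  · intro j hj
    simp only [dropRow, if_pos hj]
    rfl
  · funext i j
    rcases i with _ | _ | i <;> rcases j with _ | j
    all_goals simp only [addRow]
    any_goals exact (ha.zero_outside _ _ (by omega)).symm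
    · split_ifs with h
      · exact (hk j (by omega)).symm
      · exact (ha.zero_outside _ _ (by omega)).symm
    · rw [dropRow, if_neg (by omega)]

theorem trianglesAbove_succ (n : ℕ) (k : ℕ → ℤ) :
    trianglesAbove (n + 1) k =
      ⋃ l ∈ {l | l ∈ rowsAbove k n ∧ StrictAbove k n l}, addRow n k '' trianglesAbove n l := by
  ext a
  simp only [Set.mem_iUnion, Set.mem_ofPred_eq, Set.mem_image, exists_prop]
  constructor
  · intro ha
    obtain ⟨l, h1, h2, b, hb, rfl⟩ := exists_addRow_eq ha
    exact ⟨l, ⟨h1, h2⟩, b, hb, rfl⟩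
  · rintro ⟨l, ⟨h1, h2⟩, b, hb, rfl⟩
    exact addRow_mem (mem_rowsAbove.mp h1).1 h2 hb

theorem addRow_injOn (n : ℕ) (k : ℕ → ℤ) {b b' : ℕ → ℕ → ℤ} (hb : IsWeakMonotoneTriangle n b)
    (hb' : IsWeakMonotoneTriangle n b') (h : addRow n k b = addRow n k b') : b = b' := by
  funext i j
  rcases i with _ | i
  · rw [hb.zero_outside _ _ (by omega), hb'.zero_outside _ _ (by omega)]
  · exact congrFun (congrFun h (i + 2)) (j + 1)

/-- A row with three equal consecutive entries is not the bottom row of a triangle. -/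
theorem trianglesAbove_eq_empty {n : ℕ} {k : ℕ → ℤ} (h : HasTriple n k) :
    trianglesAbove n k = ∅ := by
  obtain ⟨i, hi, h1, h2⟩ := h
  refine Set.eq_empty_of_forall_notMem fun a ⟨ha, hk⟩ => ?_
  -- The entry a 2 (i + 2) would have to be at least k i and less than k (i + 2).
  have e1 := ha.le_northeast 1 (i + 1) (by omega) (by omega) (by omega)
  have e2 := ha.lt_of_ne_bottom 2 (i + 3) (by omega) (by omega) (by omega)
  have e3 := hk i (by omega)
  have e4 := hk (i + 2) (by omega)
  simp only [show i + 3 - 1 = i + 2 by omega, show 2 - 1 = 1 by rfl, show 1 + 1 = 2 by rfl,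
    show i + 1 + 1 = i + 2 by rfl, show i + 2 + 1 = i + 3 by rfl] at e1 e2 e4
  omega

theorem trianglesAbove_zero (k : ℕ → ℤ) : trianglesAbove 0 k = {0} := by
  ext a
  simp only [Set.mem_singleton_iff]
  constructor
  · rintro ⟨ha, _⟩
    funext i j
    exact ha.zero_outside i j (by omega)
  · rintro rfl
    exact ⟨⟨⟨fun _ _ _ _ h => by omega, fun _ _ _ _ h => by omega, fun _ _ _ => rfl⟩,
      fun _ _ _ _ h => by omega⟩, fun _ h => by omega⟩

variable {K : Type*} [Field K]

/-- The factor of the `P`-weight of a triangle that belongs to the entry `a (i + 1) (j + 1)`. -/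
def cellWeight (P : K) (a : ℕ → ℕ → ℤ) (i j : ℕ) : K :=
  if 0 < i ∧ i ≤ j ∧ a (i + 1) (j + 1) < a i (j + 1) then
    P ^ a (i + 1) (j + 1) - if i < j ∧ a (i + 1) (j + 1) = a (i + 1) j then 1 else 0 else 1

theorem pWeight_eq_prod (P : K) (n : ℕ) (a : ℕ → ℕ → ℤ) :
    pWeight P n a = ∏ i ∈ Finset.range n, ∏ j ∈ Finset.range n, cellWeight P a i j := by
  have hIcc : ∀ f : ℕ → K, ∏ i ∈ Finset.Icc 1 n, f i = ∏ i ∈ Finset.range n, f (i + 1) := by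
    intro f
    rw [Finset.range_eq_Ico, Finset.prod_Ico_add' f 0 n 1]
    rfl
  rw [pWeight, strictIndices, Finset.prod_filter, Finset.prod_product, hIcc]
  refine Finset.prod_congr rfl fun i _ => ?_
  rw [hIcc]
  refine Finset.prod_congr rfl fun j _ => ?_
  simp only [cellWeight, Nat.add_sub_cancel, Nat.lt_add_left_iff_pos, Nat.add_le_add_iff_right,
    Nat.add_lt_add_iff_right]

/-- The cells of the second row give the row weight and the higher ones are those of `b`, shifted in
both indices. The bottom row and the leftmost column of the index square carry no factor. -/
theorem pWeight_addRow (P : K) {n : ℕ} {k l : ℕ → ℤ} (hs : StrictAbove k n l)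
    {b : ℕ → ℕ → ℤ} (hb : b ∈ trianglesAbove n l) :
    pWeight P (n + 1) (addRow n k b) = rowWeight P k n l * pWeight P n b := by
  have h0 : ∀ (a : ℕ → ℕ → ℤ) (j : ℕ), cellWeight P a 0 j = 1 := by
    intro a j; simp [cellWeight]
  have h1 : ∀ (a : ℕ → ℕ → ℤ) (i : ℕ), cellWeight P a (i + 1) 0 = 1 := by
    intro a j; simp [cellWeight]
  have h2 : ∀ i j, cellWeight P (addRow n k b) (i + 1 + 1) (j + 1) = cellWeight P b (i + 1) j := by
    intro i j
    rcases j with _ | j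
    · simp [cellWeight]
    · simp [cellWeight, addRow]
  have h3 : ∀ j ∈ Finset.range n, cellWeight P (addRow n k b) (0 + 1) (j + 1) =
      entryWeight P k j l (l j) := by
    intro j hj
    have hj := Finset.mem_range.mp hj
    rw [entryWeight, if_neg (by have := hs j hj; omega)]
    have hbj := hb.2 j hj
    rcases j with _ | j
    · simp [cellWeight, addRow, hbj, show 1 ≤ n by omega]
    · have hbj' := hb.2 j (by omega)
      simp [cellWeight, addRow, hbj, hbj', show j + 1 + 1 ≤ n by omega]
  rw [pWeight_eq_prod, pWeight_eq_prod, Finset.prod_range_succ', rowWeight,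
    ← Finset.prod_congr rfl h3]
  simp only [h0, Finset.prod_const_one, mul_one]
  simp only [Finset.prod_range_succ' _ n, h1, mul_one]
  rcases n with _ | n
  · simp
  · rw [Finset.prod_range_succ', Finset.prod_range_succ' (fun i => ∏ j ∈ Finset.range (n + 1), _)]
    simp only [h0, h2, Finset.prod_const_one, mul_one]
    rw [mul_comm]

/-- The weighted enumeration of triangles is given by the operator formula. -/
theorem finsum_trianglesAbove {P : K} (hP0 : P ≠ 0) (n : ℕ)
    (hP : ∀ m : ℕ, 0 < m → m < n → P ^ m ≠ 1) {k : ℕ → ℤ}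
    (hk : ∀ j, j + 1 < n → k j ≤ k (j + 1)) :
    (trianglesAbove n k).Finite ∧
      ∑ᶠ a ∈ trianglesAbove n k, pWeight P n a = operatorFormula P n k := by
  classical
  induction n generalizing k with
  | zero =>
    rw [trianglesAbove_zero]
    refine ⟨Set.finite_singleton _, ?_⟩
    rw [finsum_mem_singleton]
    simp [pWeight_eq_prod, operatorFormula, pairPolyProd, funDet]
  | succ n ih =>
    have hk' : ∀ j < n, k j ≤ k (j + 1) := fun j hj => hk j (by omega)
    have ih' : ∀ l, Interlaces k n l → (trianglesAbove n l).Finite ∧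
        ∑ᶠ a ∈ trianglesAbove n l, pWeight P n a = operatorFormula P n l := by
      intro l hl
      refine ih (fun m h1 h2 => hP m h1 (by omega)) fun j hj => ?_
      exact (hl j (by omega)).2.trans (hl (j + 1) hj).1
    have hfin : {l | l ∈ rowsAbove k n ∧ StrictAbove k n l}.Finite :=
      (rowsAbove k n).finite_toSet.subset fun l hl => hl.1
    have hfin' : ∀ l ∈ {l | l ∈ rowsAbove k n ∧ StrictAbove k n l},
        (addRow n k '' trianglesAbove n l).Finite := fun l hl =>
      (ih' l (mem_rowsAbove.mp hl.1).1).1.image _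
    rw [trianglesAbove_succ]
    refine ⟨hfin.biUnion hfin', ?_⟩
    rw [finsum_mem_biUnion _ hfin hfin']
    · rw [← sum_rowWeight_operatorFormula hP0 (fun m h1 h2 => hP m h1 (by omega)) hk']
      · have hS : {l | l ∈ rowsAbove k n ∧ StrictAbove k n l} =
            ((rowsAbove k n).filter (StrictAbove k n) : Finset (ℕ → ℤ)) := by
          ext; simp
        rw [hS, finsum_mem_coe_finset, Finset.sum_filter]
        refine Finset.sum_congr rfl fun l hl => ?_
        split_ifs with hs
        · rw [finsum_mem_image fun b hb b' hb' h => addRow_injOn n k hb.1 hb'.1 h,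
            finsum_mem_congr rfl fun b hb => pWeight_addRow P hs hb,
            ← mul_finsum_mem,
            (ih' l (mem_rowsAbove.mp hl).1).2]
        -- A row that violates strictness has a factor 0.
        · simp only [StrictAbove, not_forall] at hs
          obtain ⟨j, hj, h0, hlt⟩ := hs
          rw [rowWeight, Finset.prod_eq_zero (Finset.mem_range.mpr hj), zero_mul]
          rw [entryWeight, if_pos ⟨h0, hlt⟩]
      -- By the induction hypothesis the formula at a row with a triple is an empty sum.
      · intro l hl ht
        rw [← (ih' l hl).2, trianglesAbove_eq_empty ht, finsum_mem_empty]
    · rintro l ⟨hl, _⟩ l' ⟨hl', _⟩ hne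
      refine Set.disjoint_left.mpr ?_
      rintro _ ⟨b, hb, rfl⟩ ⟨b', hb', h⟩
      obtain rfl := addRow_injOn n k hb'.1 hb.1 h
      refine hne (funext fun j => ?_)
      by_cases hj : j < n
      · rw [← hb.2 j hj, ← hb'.2 j hj]
      · rw [(mem_rowsAbove.mp hl).2 j (by omega), (mem_rowsAbove.mp hl').2 j (by omega)]

end Triangles

/-! ### Return to finitely many variables and to the stated normalization. -/

section Translation

variable {K : Type*} [Field K]

theorem prod_pairs_eq_prod_range {M : Type*} [CommMonoid M] (n : ℕ) (f : ℕ → ℕ → M) :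
    ∏ p ∈ Finset.univ.filter (fun p : Fin n × Fin n => p.1 < p.2), f p.1 p.2 =
      ∏ t ∈ Finset.range n, ∏ s ∈ Finset.range t, f s t := by
  rw [Finset.prod_filter, ← Finset.univ_product_univ, Finset.prod_product_right,
    Finset.prod_range]
  refine Finset.prod_congr rfl fun t _ => ?_
  simp only [Fin.lt_def]
  rw [← Finset.prod_range (fun s => if s < (t : ℕ) then f s t else 1), ← Finset.prod_filter]
  refine Finset.prod_congr ?_ fun _ _ => rfl
  ext s
  simp only [Finset.mem_range, Finset.mem_filter]
  omega

theorem pairOpProd_eq_polyAct (P : K) (n : ℕ) :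
    pairOpProd P n = polyAct P (Fin n)
      (∏ p ∈ Finset.univ.filter (fun p : Fin n × Fin n => p.1 < p.2), pairPoly K p) := by
  have hD : ∀ x : Fin n, pDelta P x = diffOp P x := fun x => rfl
  have h : ∀ p : Fin n × Fin n, pairOp P p = polyAct P (Fin n) (pairPoly K p) := by
    intro p
    simp only [pairOp, pShift, pairPoly, map_add, map_mul, map_one, polyAct_X, hD]
  have key : ∀ (s : Finset (Fin n × Fin n)) (comm), s.noncommProd (pairOp P) comm =
      polyAct P (Fin n) (∏ p ∈ s, pairPoly K p) := by
    intro s comm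
    induction s using Finset.induction_on with
    | empty => simp
    | insert p s hp ih =>
      rw [Finset.noncommProd_insert_of_notMem _ _ _ _ hp, Finset.prod_insert hp, map_mul, ih, h]
  exact key _ _

theorem diffOp_comp_val (P : K) (n x : ℕ) (f : (Fin n → ℤ) → K) :
    diffOp P x (LinearMap.funLeft K K (fun l : ℕ → ℤ => l ∘ (Fin.val : Fin n → ℕ)) f) =
      LinearMap.funLeft K K (fun l : ℕ → ℤ => l ∘ (Fin.val : Fin n → ℕ))
        (polyAct P (Fin n) (if h : x < n then X ⟨x, h⟩ else 0) f) := by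
  ext l
  by_cases h : x < n
  · have : Function.update l x (l x + 1) ∘ (Fin.val : Fin n → ℕ) =
        Function.update (l ∘ Fin.val) ⟨x, h⟩ (l x + 1) :=
      Function.update_comp_eq_of_injective l Fin.val_injective ⟨x, h⟩ _
    simp [h, diffOp_apply, LinearMap.funLeft_apply, this]
  · have : Function.update l x (l x + 1) ∘ (Fin.val : Fin n → ℕ) = l ∘ Fin.val := by
      refine Function.update_comp_eq_of_notMem_range _ _ ?_
      rintro ⟨a, rfl⟩
      exact h a.2
    simp [h, diffOp_apply, LinearMap.funLeft_apply, this]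

/-- Extracting P^(s+1) from each factor gives, for fixed t, the exponent 1 + ⋯ + t = C(t+1, 2);
summing over t < n gives C(n+1, 3). -/
theorem prod_pow_sub_pow (P : K) (n : ℕ) :
    ∏ t ∈ Finset.range n, ∏ s ∈ Finset.range t, (P ^ (t + 1) - P ^ (s + 1)) =
      P ^ ((n + 1).choose 3) *
        ∏ t ∈ Finset.range n, ∏ r ∈ Finset.range t, (P ^ (r + 1) - 1) := by
  induction n with
  | zero => simp [Nat.choose_eq_zero_of_lt (show 0 + 1 < 3 by omega)]
  | succ n ih =>
    have h : ∏ s ∈ Finset.range n, (P ^ (n + 1) - P ^ (s + 1)) =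
        P ^ ((n + 1).choose 2) * ∏ r ∈ Finset.range n, (P ^ (r + 1) - 1) := by
      have h1 : ∀ s ∈ Finset.range n, P ^ (n + 1) - P ^ (s + 1) =
          P ^ (s + 1) * (P ^ (n - 1 - s + 1) - 1) := by
        intro s hs
        have := Finset.mem_range.mp hs
        rw [mul_sub, ← pow_add, mul_one, show s + 1 + (n - 1 - s + 1) = n + 1 by omega]
      rw [Finset.prod_congr rfl h1, Finset.prod_mul_distrib,
        Finset.prod_range_reflect (fun r => P ^ (r + 1) - 1), Finset.prod_pow_eq_pow_sum]
      congr 2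
      rw [← add_zero (∑ s ∈ Finset.range n, (s + 1)), ← Finset.sum_range_succ' (fun s => s),
        Finset.sum_range_id, Nat.choose_two_right]
    rw [Finset.prod_range_succ, ih, h, Finset.prod_range_succ, Nat.choose_succ_succ (n + 1) 2,
      pow_add]
    ring

/-- Removing the column denominators leaves the Vandermonde determinant in P^(l m); by
`prod_pow_sub_pow` they are the denominators of `pVandermonde` up to the power of P. -/
theorem funDet_divPow_eq {P : K} (hP0 : P ≠ 0) (n : ℕ) (l : ℕ → ℤ) :
    funDet n (divPow P) l = P ^ ((n + 1).choose 3) * pVandermonde P n (l ∘ Fin.val) := by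
  have h1 : funDet n (divPow P) l =
      (∏ j : Fin n, (∏ r ∈ Finset.range j, (P ^ (r + 1) - 1))⁻¹) *
        (Matrix.vandermonde fun m : Fin n => P ^ l m).det := by
    rw [← Matrix.det_mul_row, funDet]
    congr 2
    funext m j
    rw [divPow, Matrix.vandermonde_apply, div_eq_inv_mul]
  have h2 : (Matrix.vandermonde fun m : Fin n => P ^ l m).det =
      ∏ p ∈ Finset.univ.filter (fun p : Fin n × Fin n => p.1 < p.2), (P ^ l p.2 - P ^ l p.1) := by
    rw [Matrix.det_vandermonde, Finset.prod_filter, ← Finset.univ_product_univ,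
      Finset.prod_product]
    refine Finset.prod_congr rfl fun i _ => ?_
    rw [← Finset.prod_filter, Finset.filter_lt_eq_Ioi]
  rw [h1, h2, pVandermonde, Finset.prod_div_distrib,
    prod_pairs_eq_prod_range n fun s t => P ^ (t + 1) - P ^ (s + 1), prod_pow_sub_pow,
    Finset.prod_inv_distrib, ← Finset.prod_range fun j => ∏ r ∈ Finset.range j, (P ^ (r + 1) - 1)]
  have h3 : P ^ ((n + 1).choose 3) ≠ 0 := pow_ne_zero _ hP0
  simp only [Function.comp_apply]
  rw [← mul_div_assoc, mul_div_mul_left _ _ h3, div_eq_inv_mul]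

theorem operatorFormula_eq {P : K} (hP0 : P ≠ 0) (n : ℕ) (k : ℕ → ℤ) :
    operatorFormula P n k =
      P ^ ((n + 1).choose 3) * pairOpProd P n (pVandermonde P n) (k ∘ Fin.val) := by
  have h : funDet n (divPow P) =
      LinearMap.funLeft K K (fun l : ℕ → ℤ => l ∘ (Fin.val : Fin n → ℕ))
        (P ^ ((n + 1).choose 3) • pVandermonde P n) :=
    funext fun l => funDet_divPow_eq hP0 n l
  have hq : aeval (fun x => if h : x < n then X ⟨x, h⟩ else 0 : ℕ → MvPolynomial (Fin n) K)
      (pairPolyProd K n) =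
      ∏ p ∈ Finset.univ.filter (fun p : Fin n × Fin n => p.1 < p.2), pairPoly K p := by
    rw [pairPolyProd_eq, ← prod_pairs_eq_prod_range n fun s t => pairPoly K (s, t), map_prod]
    refine Finset.prod_congr rfl fun p _ => ?_
    simp [pairPoly]
  rw [operatorFormula, h, polyAct_intertwine P _ _ (diffOp_comp_val P n), hq,
    ← pairOpProd_eq_polyAct, map_smul]
  rfl

end Translation

theorem theorem2 {K : Type*} [Field K] (P : K) (n : ℕ) (hP0 : P ≠ 0)
    (hP : ∀ m : ℕ, 0 < m → m < n → P ^ m ≠ 1)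
    (k : Fin n → ℤ) (hk : Monotone k) :
    (weakMonotoneTriangles k).Finite ∧
      ∑ᶠ a ∈ weakMonotoneTriangles k, pWeight P n a =
        P ^ ((n + 1).choose 3) * pairOpProd P n (pVandermonde P n) k := by
  let k' : ℕ → ℤ := fun j => if h : j < n then k ⟨j, h⟩ else 0
  have hk' : k' ∘ Fin.val = k := by
    funext j
    simp [k']
  have hset : weakMonotoneTriangles k = trianglesAbove n k' := by
    ext a
    simp only [weakMonotoneTriangles, trianglesAbove, Set.mem_ofPred_eq]
    refine and_congr_right fun _ => ⟨fun h j hj => ?_, fun h j => ?_⟩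
    · rw [show k' j = k ⟨j, hj⟩ by simp [k', hj]]
      exact h ⟨j, hj⟩
    · rw [h j j.2]
      exact congrFun hk' j
  have hmono : ∀ j, j + 1 < n → k' j ≤ k' (j + 1) := by
    intro j hj
    rw [show k' j = k ⟨j, by omega⟩ by simp [k', show j < n by omega],
      show k' (j + 1) = k ⟨j + 1, hj⟩ by simp [k', hj]]
    exact hk (by simp)
  have h := finsum_trianglesAbove hP0 n hP hmono
  rw [operatorFormula_eq hP0, hk'] at h
  rwa [hset]
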